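/- Let $L$ be a distributive lattice with bottom element $0$ that is completely normal, i.e., for all $a,b\in L$ there exist $u,v\in L$ such that $a\leq u\vee b$, $b\leq a\vee v$, and $u\wedge v=0$. If $L$ has at most $\aleph_1$ elements, then there exist an Abelian lattice-ordered group $G$ and a surjective lattice homomorphism, preserving $0$, from $\mathrm{Id}_c(G)$ onto $L$. Here $\mathrm{Id}_c(G)$ denotes the lattice, ordered by inclusion, of all principal $\ell$-ideals $\langle a\rangle=\{x\in G : |x|\leq na\text{ for some }n\in\mathbb{N}\}$ of $G$, where $a\in G$ and $a\geq 0$. -/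

import Mathlib

universe u

/-- Two elements `a`, `b` of a lattice with bottom element are *consonant* if there are `u`, `v`
with `a ≤ u ⊔ b`, `b ≤ a ⊔ v` and `u ⊓ v = ⊥`. -/
def Consonant {D : Type*} [Lattice D] [OrderBot D] (a b : D) : Prop :=
  ∃ u v : D, a ≤ u ⊔ b ∧ b ≤ a ⊔ v ∧ u ⊓ v = ⊥

/-- A lattice with bottom element is *completely normal* if any two elements are consonant. -/
def CompletelyNormal (D : Type*) [Lattice D] [OrderBot D] : Prop :=
  ∀ a b : D, Consonant a b

/-- An *ℓ-ideal* of an Abelian lattice-ordered group `G` (written additively): an order-convex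
subgroup closed under the lattice operations. (Normality is automatic, as `G` is Abelian.) -/
structure LIdeal (G : Type*) [AddCommGroup G] [Lattice G] extends AddSubgroup G where
  ordConnected' : carrier.OrdConnected
  sup_mem' : ∀ {x y : G}, x ∈ carrier → y ∈ carrier → x ⊔ y ∈ carrier
  inf_mem' : ∀ {x y : G}, x ∈ carrier → y ∈ carrier → x ⊓ y ∈ carrier

namespace LIdeal

instance {G : Type*} [AddCommGroup G] [Lattice G] : SetLike (LIdeal G) G where
  coe I := I.carrier
  coe_injective := by
    rintro ⟨I, _, _, _⟩ ⟨J, _, _, _⟩ h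
    have : I = J := SetLike.coe_injective h
    subst this
    rfl

/-- ℓ-ideals are ordered by inclusion. -/
instance {G : Type*} [AddCommGroup G] [Lattice G] : PartialOrder (LIdeal G) :=
  PartialOrder.lift (fun I => (I : Set G)) SetLike.coe_injective

theorem le_def {G : Type*} [AddCommGroup G] [Lattice G] {I J : LIdeal G} :
    I ≤ J ↔ ∀ x ∈ I, x ∈ J :=
  Iff.rfl

theorem mem_of_abs_le {G : Type*} [AddCommGroup G] [Lattice G] [IsOrderedAddMonoid G]
    (I : LIdeal G) {x y : G} (hy : y ∈ I) (h : |x| ≤ y) : x ∈ I :=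
  I.ordConnected'.out (I.neg_mem' hy) hy
    ⟨(neg_le_neg h).trans (neg_le.1 (neg_le_abs x)), (le_abs_self x).trans h⟩

/-- The principal ℓ-ideal `⟨a⟩ = {x | ∃ n : ℕ, |x| ≤ n • a}`, for `a ≥ 0`. -/
def principal {G : Type*} [AddCommGroup G] [Lattice G] [IsOrderedAddMonoid G]
    (a : G) (ha : 0 ≤ a) : LIdeal G where
  carrier := {x | ∃ n : ℕ, |x| ≤ n • a}
  zero_mem' := ⟨0, by simp⟩
  add_mem' := by
    rintro x y ⟨m, hm⟩ ⟨n, hn⟩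
    refine ⟨m + n, ?_⟩
    rw [add_nsmul]
    refine abs_le'.2 ⟨?_, ?_⟩
    · exact add_le_add ((le_abs_self x).trans hm) ((le_abs_self y).trans hn)
    · rw [neg_add]
      exact add_le_add ((neg_le_abs x).trans hm) ((neg_le_abs y).trans hn)
  neg_mem' := by
    rintro x ⟨m, hm⟩
    exact ⟨m, by rwa [abs_neg]⟩
  ordConnected' := by
    refine ⟨?_⟩
    rintro x ⟨m, hm⟩ y ⟨n, hn⟩ z ⟨hxz, hzy⟩
    refine ⟨m + n, abs_le'.2 ⟨?_, ?_⟩⟩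
    · exact (hzy.trans ((le_abs_self y).trans hn)).trans
        (nsmul_le_nsmul_left ha (Nat.le_add_left n m))
    · exact ((neg_le_neg hxz).trans ((neg_le_abs x).trans hm)).trans
        (nsmul_le_nsmul_left ha (Nat.le_add_right m n))
  sup_mem' := by
    rintro x y ⟨m, hm⟩ ⟨n, hn⟩
    have h1 := hm.trans (nsmul_le_nsmul_left ha (Nat.le_add_right m n))
    have h2 := hn.trans (nsmul_le_nsmul_left ha (Nat.le_add_left n m))
    refine ⟨m + n, abs_le'.2 ⟨sup_le ((le_abs_self x).trans h1) ((le_abs_self y).trans h2), ?_⟩⟩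
    exact (neg_le_neg le_sup_left).trans ((neg_le_abs x).trans h1)
  inf_mem' := by
    rintro x y ⟨m, hm⟩ ⟨n, hn⟩
    have h1 := hm.trans (nsmul_le_nsmul_left ha (Nat.le_add_right m n))
    have h2 := hn.trans (nsmul_le_nsmul_left ha (Nat.le_add_left n m))
    refine ⟨m + n, abs_le'.2 ⟨inf_le_left.trans ((le_abs_self x).trans h1), ?_⟩⟩
    rw [neg_inf]
    exact sup_le ((neg_le_abs x).trans h1) ((neg_le_abs y).trans h2)

theorem mem_principal {G : Type*} [AddCommGroup G] [Lattice G] [IsOrderedAddMonoid G]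
    {a : G} {ha : 0 ≤ a} {x : G} : x ∈ principal a ha ↔ ∃ n : ℕ, |x| ≤ n • a :=
  Iff.rfl

/-- `⟨a⟩` is the least ℓ-ideal containing `a`. -/
theorem principal_le_iff {G : Type*} [AddCommGroup G] [Lattice G] [IsOrderedAddMonoid G]
    {a : G} {ha : 0 ≤ a} {I : LIdeal G} : principal a ha ≤ I ↔ a ∈ I := by
  constructor
  · intro h
    exact le_def.1 h a (mem_principal.2 ⟨1, by rw [abs_of_nonneg ha, one_nsmul]⟩)
  · rintro h x ⟨n, hn⟩
    exact I.mem_of_abs_le (I.toAddSubgroup.nsmul_mem h n) hn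

theorem mem_of_nonneg_of_le {G : Type*} [AddCommGroup G] [Lattice G] [IsOrderedAddMonoid G]
    (I : LIdeal G) {x y : G} (hy : y ∈ I) (hx : 0 ≤ x) (h : x ≤ y) : x ∈ I :=
  I.mem_of_abs_le hy (by rwa [abs_of_nonneg hx])

theorem nsmul_inf_le {G : Type*} [AddCommGroup G] [Lattice G] [IsOrderedAddMonoid G]
    {x a b : G} (hx : 0 ≤ x) (ha : 0 ≤ a) (hb : 0 ≤ b) {m n : ℕ} (hm : x ≤ m • a)
    (hn : x ≤ n • b) : x ≤ (m * n) • (a ⊓ b) := by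
  have step : ∀ (c d : G), 0 ≤ c → 0 ≤ d → ∀ k : ℕ, c ⊓ (k • d) ≤ k • (c ⊓ d) := by
    intro c d hc hd k
    induction k with
    | zero => simp
    | succ k ih =>
      rw [succ_nsmul, succ_nsmul]
      have hkd : 0 ≤ k • d := nsmul_nonneg hd k
      have h1 : c ⊓ (k • d + d) ≤ (c ⊓ k • d) + (c ⊓ d) := by
        rw [inf_add, add_inf, add_inf]
        refine le_inf (le_inf ?_ ?_) (le_inf ?_ ?_)
        · exact inf_le_left.trans (le_add_of_nonneg_left hc)
        · exact inf_le_left.trans (le_add_of_nonneg_right hd)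
        · exact inf_le_left.trans (le_add_of_nonneg_left hkd)
        · exact inf_le_right
      exact h1.trans (add_le_add_left ih _)
  have h1 : x ≤ m • (x ⊓ a) := by
    have := step x a hx ha m
    rwa [inf_eq_left.2 hm] at this
  have h2 : x ⊓ a ≤ n • (a ⊓ b) := by
    have h3 : x ⊓ a ≤ a ⊓ (n • b) := le_inf inf_le_right (inf_le_left.trans hn)
    exact h3.trans (step a b ha hb n)
  refine h1.trans ?_
  rw [mul_comm, mul_nsmul]
  exact nsmul_le_nsmul_right h2 m

end LIdeal

/-- `Id_c(G)`: the set of all principal ℓ-ideals of `G`, ordered by inclusion. -/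
def Idc (G : Type*) [AddCommGroup G] [Lattice G] [IsOrderedAddMonoid G] : Type _ :=
  {I : LIdeal G // ∃ (a : G) (ha : 0 ≤ a), I = LIdeal.principal a ha}

namespace Idc

instance {G : Type*} [AddCommGroup G] [Lattice G] [IsOrderedAddMonoid G] :
    PartialOrder (Idc G) :=
  inferInstanceAs (PartialOrder
    {I : LIdeal G // ∃ (a : G) (ha : 0 ≤ a), I = LIdeal.principal a ha})

/-- The element `⟨a⟩` of `Id_c(G)`. -/
def mk {G : Type*} [AddCommGroup G] [Lattice G] [IsOrderedAddMonoid G] (a : G) (ha : 0 ≤ a) :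
    Idc G :=
  ⟨LIdeal.principal a ha, a, ha, rfl⟩

theorem exists_rep {G : Type*} [AddCommGroup G] [Lattice G] [IsOrderedAddMonoid G] (I : Idc G) :
    ∃ (a : G) (ha : 0 ≤ a), I = mk a ha := by
  obtain ⟨I, a, ha, rfl⟩ := I
  exact ⟨a, ha, rfl⟩

theorem mk_le_mk {G : Type*} [AddCommGroup G] [Lattice G] [IsOrderedAddMonoid G] {a b : G}
    {ha : 0 ≤ a} {hb : 0 ≤ b} : mk a ha ≤ mk b hb ↔ ∃ n : ℕ, a ≤ n • b := by
  have h : LIdeal.principal a ha ≤ LIdeal.principal b hb ↔ ∃ n : ℕ, a ≤ n • b := by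
    rw [LIdeal.principal_le_iff, LIdeal.mem_principal, abs_of_nonneg ha]
  exact h

theorem isLUB_mk {G : Type*} [AddCommGroup G] [Lattice G] [IsOrderedAddMonoid G] {a b : G}
    (ha : 0 ≤ a) (hb : 0 ≤ b) :
    IsLUB {mk a ha, mk b hb} (mk (a ⊔ b) (ha.trans le_sup_left)) := by
  constructor
  · rintro J (rfl | rfl)
    · exact mk_le_mk.2 ⟨1, by simp⟩
    · exact mk_le_mk.2 ⟨1, by simp⟩
  · intro J hJ
    have h1 : LIdeal.principal a ha ≤ J.1 := hJ (Or.inl rfl)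
    have h2 : LIdeal.principal b hb ≤ J.1 := hJ (Or.inr rfl)
    exact (LIdeal.principal_le_iff (ha := ha.trans le_sup_left)).2
      (J.1.sup_mem' (LIdeal.principal_le_iff.1 h1) (LIdeal.principal_le_iff.1 h2))

theorem isGLB_mk {G : Type*} [AddCommGroup G] [Lattice G] [IsOrderedAddMonoid G] {a b : G}
    (ha : 0 ≤ a) (hb : 0 ≤ b) :
    IsGLB {mk a ha, mk b hb} (mk (a ⊓ b) (le_inf ha hb)) := by
  constructor
  · rintro J (rfl | rfl)
    · exact mk_le_mk.2 ⟨1, by simp⟩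
    · exact mk_le_mk.2 ⟨1, by simp⟩
  · intro J hJ
    obtain ⟨c, hc, rfl⟩ := exists_rep J
    obtain ⟨m, hm⟩ := mk_le_mk.1 (hJ (Or.inl rfl))
    obtain ⟨n, hn⟩ := mk_le_mk.1 (hJ (Or.inr rfl))
    exact mk_le_mk.2 ⟨m * n, LIdeal.nsmul_inf_le hc ha hb hm hn⟩

/-- `Id_c(G)` is a lattice under inclusion; its operations are the least upper bound and the
greatest lower bound for inclusion, see `Idc.mk_sup_mk` and `Idc.mk_inf_mk`. -/
noncomputable instance {G : Type*} [AddCommGroup G] [Lattice G] [IsOrderedAddMonoid G] :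
    Lattice (Idc G) where
  sup I J := mk (I.2.choose ⊔ J.2.choose) (I.2.choose_spec.choose.trans le_sup_left)
  inf I J := mk (I.2.choose ⊓ J.2.choose)
    (le_inf I.2.choose_spec.choose J.2.choose_spec.choose)
  le_sup_left I J := by
    have h := (isLUB_mk I.2.choose_spec.choose J.2.choose_spec.choose).1 (Or.inl rfl)
    exact (le_of_eq (Subtype.ext I.2.choose_spec.choose_spec)).trans h
  le_sup_right I J := by
    have h := (isLUB_mk I.2.choose_spec.choose J.2.choose_spec.choose).1 (Or.inr rfl)
    exact (le_of_eq (Subtype.ext J.2.choose_spec.choose_spec)).trans h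
  sup_le I J K hI hJ := by
    refine (isLUB_mk I.2.choose_spec.choose J.2.choose_spec.choose).2 ?_
    rintro M (rfl | rfl)
    · exact (le_of_eq (Subtype.ext I.2.choose_spec.choose_spec.symm)).trans hI
    · exact (le_of_eq (Subtype.ext J.2.choose_spec.choose_spec.symm)).trans hJ
  inf_le_left I J := by
    have h := (isGLB_mk I.2.choose_spec.choose J.2.choose_spec.choose).1 (Or.inl rfl)
    exact h.trans (le_of_eq (Subtype.ext I.2.choose_spec.choose_spec.symm))
  inf_le_right I J := by
    have h := (isGLB_mk I.2.choose_spec.choose J.2.choose_spec.choose).1 (Or.inr rfl)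
    exact h.trans (le_of_eq (Subtype.ext J.2.choose_spec.choose_spec.symm))
  le_inf I J K hJ hK := by
    refine (isGLB_mk J.2.choose_spec.choose K.2.choose_spec.choose).2 ?_
    rintro M (rfl | rfl)
    · exact hJ.trans (le_of_eq (Subtype.ext J.2.choose_spec.choose_spec))
    · exact hK.trans (le_of_eq (Subtype.ext K.2.choose_spec.choose_spec))

/-- The bottom element of `Id_c(G)` is `⟨0⟩ = {0}`. -/
instance {G : Type*} [AddCommGroup G] [Lattice G] [IsOrderedAddMonoid G] : OrderBot (Idc G) where
  bot := mk 0 le_rfl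
  bot_le I := by
    obtain ⟨a, ha, rfl⟩ := exists_rep I
    exact mk_le_mk.2 ⟨0, by simp⟩

theorem mk_sup_mk {G : Type*} [AddCommGroup G] [Lattice G] [IsOrderedAddMonoid G] {a b : G}
    (ha : 0 ≤ a) (hb : 0 ≤ b) :
    mk a ha ⊔ mk b hb = mk (a ⊔ b) (ha.trans le_sup_left) :=
  isLUB_pair.unique (isLUB_mk ha hb)

theorem mk_inf_mk {G : Type*} [AddCommGroup G] [Lattice G] [IsOrderedAddMonoid G] {a b : G}
    (ha : 0 ≤ a) (hb : 0 ≤ b) :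
    mk a ha ⊓ mk b hb = mk (a ⊓ b) (le_inf ha hb) :=
  isGLB_pair.unique (isGLB_mk ha hb)

end Idc

/-! For a homomorphism `f` from `Id_c(G)` to `L`, the map `φ x = f ⟨x ⊔ 0⟩` is subadditive, vanishes
at `0`, and satisfies `φ x ⊓ φ (-x) = ⊥`. The proof reverses this: it builds such a cone map `φ`,
surjective, on a rational vector space, and recovers an ℓ-group from it.

From cone map to ℓ-group (`IsConeMap.exists_surjective_latticeHom`): each prime ideal `P` of `L`
turns `φ` into a total preorder, hence into a totally ordered quotient `Q P`. In the product of the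
`Q P`, take the ℓ-subgroup `G` generated by the image of the vector space. For `g ∈ G`, the set of
`P` at which `g` is nonpositive is given by a single element of `L`, because joins and meets of
comparisons turn into meets and joins in `L`. That element depends only on the principal ideal when
`g ≥ 0`.

Construction of `φ` (`CompletelyNormal.exists_isConeMap`): adjoin basis vectors one at a time along
`ω₁`, each with a prescribed value. Adjoining `t` to `W` means choosing the truth values of `t < v`
and `v < t` for all `v ∈ W`. Complete normality extends finitely many such choices to one more `v`
(`IsPartialCut.exists_insert`); if `W` is countable, a sequence of finite stages reaches every `v`.
Proper initial segments of `ω₁` being countable, every step is over a countable `W`; this is where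
the bound `ℵ₁` enters. -/

/-- Two elements of a distributive lattice are compared by the prime ideals containing them. -/
theorem le_of_forall_prime_ideal {D : Type*} [DistribLattice D] {a b : D}
    (h : ∀ P : Order.Ideal D, P.IsPrime → b ∈ P → a ∈ P) : a ≤ b := by
  by_contra hab
  have hd : Disjoint (Order.PFilter.principal a : Set D) (Order.Ideal.principal b : Set D) := by
    rw [Set.disjoint_left]
    intro x hx hx'
    exact hab (le_trans (Order.PFilter.mem_principal.1 hx) (Order.Ideal.mem_principal.1 hx'))
  obtain ⟨P, hP, hbP, haP⟩ := DistribLattice.prime_ideal_of_disjoint_filter_ideal hd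
  exact Set.disjoint_left.1 haP (Order.PFilter.mem_principal.2 le_rfl)
    (h P hP (hbP (Order.Ideal.mem_principal.2 le_rfl)))

/-! ### Cone maps -/

/-- A map `φ` from an Abelian group to a distributive lattice with `⊥`, thought of as sending `x`
to the truth value of `0 < x`: at every prime ideal `P`, the set `{x | φ x ∈ P}` is the negative
cone of a total preorder. -/
structure IsConeMap {A D : Type*} [AddCommGroup A] [DistribLattice D] [OrderBot D]
    (φ : A → D) : Prop where
  map_zero : φ 0 = ⊥
  map_add_le : ∀ x y, φ (x + y) ≤ φ x ⊔ φ y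
  inf_map_neg : ∀ x, φ x ⊓ φ (-x) = ⊥

namespace IsConeMap

section AddCommGroup

variable {A D : Type*} [AddCommGroup A] [DistribLattice D] [OrderBot D] {φ : A → D}

theorem comp {B : Type*} [AddCommGroup B] (h : IsConeMap φ) (f : B →+ A) :
    IsConeMap (fun x => φ (f x)) where
  map_zero := by simp [h.map_zero]
  map_add_le x y := by simpa using h.map_add_le (f x) (f y)
  inf_map_neg x := by simpa using h.inf_map_neg (f x)

theorem disjoint_neg (h : IsConeMap φ) (x : A) : Disjoint (φ x) (φ (-x)) :=
  disjoint_iff.2 (h.inf_map_neg x)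

theorem disjoint_sub (h : IsConeMap φ) (x y : A) : Disjoint (φ (x - y)) (φ (y - x)) := by
  simpa using h.disjoint_neg (x - y)

theorem map_sub_le (h : IsConeMap φ) (x y z : A) : φ (x - z) ≤ φ (x - y) ⊔ φ (y - z) := by
  simpa using h.map_add_le (x - y) (y - z)

theorem map_nsmul_le (h : IsConeMap φ) (n : ℕ) (x : A) : φ (n • x) ≤ φ x := by
  induction n with
  | zero => simp [h.map_zero]
  | succ n ih =>
    rw [succ_nsmul]
    exact (h.map_add_le _ _).trans (sup_le ih le_rfl)

/-- For the nontrivial inequality, write `x = (n + 1) • x + n • (-x)`: the second summand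
contributes at most `φ (-x)`, which is disjoint from `φ x` and cancels. -/
theorem map_nsmul (h : IsConeMap φ) {n : ℕ} (hn : n ≠ 0) (x : A) : φ (n • x) = φ x := by
  obtain ⟨n, rfl⟩ := Nat.exists_eq_succ_of_ne_zero hn
  refine le_antisymm (h.map_nsmul_le _ x) ?_
  have h1 : φ x ≤ φ ((n + 1) • x) ⊔ φ (n • (-x)) := by
    have := h.map_add_le ((n + 1) • x) (n • (-x))
    rwa [show (n + 1) • x + n • (-x) = x by module] at this
  exact (h.disjoint_neg x).left_le_of_le_sup_right
    (h1.trans (sup_le_sup_left (h.map_nsmul_le _ _) _))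

theorem mem_or_neg_mem (h : IsConeMap φ) {P : Order.Ideal D} (hP : P.IsPrime) (x : A) :
    φ x ∈ P ∨ φ (-x) ∈ P :=
  hP.mem_or_mem (by rw [h.inf_map_neg]; exact P.bot_mem)

theorem add_mem (h : IsConeMap φ) {P : Order.Ideal D} {x y : A} (hx : φ x ∈ P) (hy : φ y ∈ P) :
    φ (x + y) ∈ P :=
  P.lower (h.map_add_le x y) (P.sup_mem hx hy)

end AddCommGroup

section Module

variable {W D : Type*} [AddCommGroup W] [Module ℚ W] [DistribLattice D] [OrderBot D] {φ : W → D}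

theorem map_smul (h : IsConeMap φ) {c : ℚ} (hc : 0 < c) (x : W) : φ (c • x) = φ x := by
  have h1 : c.den • (c • x) = c.num.toNat • x := by
    rw [← Nat.cast_smul_eq_nsmul ℚ, ← Nat.cast_smul_eq_nsmul ℚ, smul_smul]
    congr 1
    have h2 : ((c.num.toNat : ℤ) : ℚ) = (c.num : ℚ) := by
      rw [Int.toNat_of_nonneg (Rat.num_pos.2 hc).le]
    rw [mul_comm, Rat.mul_den_eq_num, ← h2, Int.cast_natCast]
  have h3 : c.num.toNat ≠ 0 := by
    have := Rat.num_pos.2 hc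
    omega
  rw [← h.map_nsmul c.den_nz (c • x), h1, h.map_nsmul h3]

end Module

end IsConeMap

/-! ### Cuts over a cone map -/

/-- The condition on two points `p = (v, [t < v], [v < t])` and `q` of a cut `t`. -/
structure CutRel {W D : Type*} [AddCommGroup W] [DistribLattice D] [OrderBot D] (φ : W → D)
    (p q : W × D × D) : Prop where
  sub_le : φ (p.1 - q.1) ≤ p.2.1 ⊔ q.2.2
  fst_le : p.2.1 ≤ q.2.1 ⊔ φ (p.1 - q.1)
  snd_le : p.2.2 ≤ q.2.2 ⊔ φ (q.1 - p.1)

/-- A partially defined cut. -/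
structure IsPartialCut {W D : Type*} [AddCommGroup W] [DistribLattice D] [OrderBot D] (φ : W → D)
    (s : Set (W × D × D)) : Prop where
  rel : ∀ p ∈ s, ∀ q ∈ s, CutRel φ p q
  disj : ∀ p ∈ s, Disjoint p.2.1 p.2.2

/-- The old points bound `x = [t < v]` above by `E` and `y = [v < t]` above by `F`. Consonance of
`E` and `F` yields disjoint `x ≤ E` and `y ≤ F` with `E ≤ x ⊔ F` and `F ≤ y ⊔ E`. Each required
lower bound on `x` holds with `E` in place of `x`; replacing `E` by `x ⊔ F` adds one unwanted term,
which cancels by disjointness. The bounds on `y` are symmetric. Nonemptiness of `s` makes the meets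
exist, as `D` may lack a top. -/
theorem IsPartialCut.exists_insert {W D : Type*} [AddCommGroup W] [DistribLattice D] [OrderBot D]
    (hD : CompletelyNormal D) {φ : W → D} (hφ : IsConeMap φ) {s : Finset (W × D × D)}
    (hne : s.Nonempty) (hs : IsPartialCut φ (s : Set (W × D × D))) (v : W) :
    ∃ x y : D, IsPartialCut φ (insert (v, x, y) (s : Set (W × D × D))) := by
  set E := s.inf' hne fun p => p.2.1 ⊔ φ (v - p.1) with hE
  set F := s.inf' hne fun p => p.2.2 ⊔ φ (p.1 - v) with hF
  have hEle : ∀ p ∈ s, E ≤ p.2.1 ⊔ φ (v - p.1) := fun p hp => Finset.inf'_le _ hp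
  have hFle : ∀ p ∈ s, F ≤ p.2.2 ⊔ φ (p.1 - v) := fun p hp => Finset.inf'_le _ hp
  have leE : ∀ c d : D, (∀ p ∈ s, c ≤ p.2.1 ⊔ φ (v - p.1) ⊔ d) → c ≤ E ⊔ d := by
    intro c d h
    rw [hE, Finset.inf'_sup_distrib_right]
    exact Finset.le_inf' _ _ h
  have leF : ∀ c d : D, (∀ p ∈ s, c ≤ p.2.2 ⊔ φ (p.1 - v) ⊔ d) → c ≤ F ⊔ d := by
    intro c d h
    rw [hF, Finset.inf'_sup_distrib_right]
    exact Finset.le_inf' _ _ h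
  obtain ⟨x₀, y₀, hx₀, hy₀, hxy⟩ := hD E F
  have hx : E ≤ (x₀ ⊓ E) ⊔ F := by
    rw [sup_inf_right]
    exact le_inf hx₀ le_sup_left
  have hy : F ≤ (y₀ ⊓ F) ⊔ E := by
    rw [sup_inf_right, sup_comm y₀]
    exact le_inf hy₀ le_sup_left
  have hd : Disjoint (x₀ ⊓ E) (y₀ ⊓ F) :=
    (disjoint_iff.2 hxy).mono inf_le_left inf_le_left
  have hxE : x₀ ⊓ E ≤ E := inf_le_right
  have hyF : y₀ ⊓ F ≤ F := inf_le_right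
  generalize x₀ ⊓ E = x at *
  generalize y₀ ⊓ F = y at *
  refine ⟨x, y, ?_, ?_⟩
  · have hself : CutRel φ (v, x, y) (v, x, y) :=
      ⟨by simp [hφ.map_zero], le_sup_left, le_sup_left⟩
    have key1 : ∀ q ∈ s, φ (v - q.1) ≤ x ⊔ q.2.2 := by
      intro q hq
      have h1 : φ (v - q.1) ≤ E ⊔ q.2.2 := by
        refine leE _ _ fun p hp => (hφ.map_sub_le v p.1 q.1).trans (sup_le ?_ ?_)
        · exact le_sup_right.trans le_sup_left
        · exact ((hs.rel p hp q hq).sub_le).trans (sup_le_sup_right le_sup_left _)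
      have h2 : φ (v - q.1) ≤ (x ⊔ q.2.2) ⊔ φ (q.1 - v) := by
        refine h1.trans (sup_le (hx.trans (sup_le ?_ ?_)) ?_)
        · exact le_sup_left.trans le_sup_left
        · exact (hFle q hq).trans (sup_le_sup_right le_sup_right _)
        · exact le_sup_right.trans le_sup_left
      exact (hφ.disjoint_sub _ _).left_le_of_le_sup_right h2
    have key2 : ∀ q ∈ s, q.2.1 ≤ x ⊔ φ (q.1 - v) := by
      intro q hq
      have h1 : q.2.1 ≤ E ⊔ φ (q.1 - v) := by
        refine leE _ _ fun p hp => ((hs.rel q hq p hp).fst_le).trans (sup_le ?_ ?_)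
        · exact le_sup_left.trans le_sup_left
        · exact (hφ.map_sub_le q.1 v p.1).trans
            (sup_le le_sup_right (le_sup_right.trans le_sup_left))
      have h2 : q.2.1 ≤ (x ⊔ φ (q.1 - v)) ⊔ q.2.2 := by
        refine h1.trans (sup_le (hx.trans (sup_le ?_ ?_)) ?_)
        · exact le_sup_left.trans le_sup_left
        · exact (hFle q hq).trans (sup_le le_sup_right (le_sup_right.trans le_sup_left))
        · exact le_sup_right.trans le_sup_left
      exact (hs.disj q hq).left_le_of_le_sup_right h2
    have key3 : ∀ q ∈ s, φ (q.1 - v) ≤ q.2.1 ⊔ y := by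
      intro q hq
      have h1 : φ (q.1 - v) ≤ F ⊔ q.2.1 := by
        refine leF _ _ fun p hp => (hφ.map_sub_le q.1 p.1 v).trans (sup_le ?_ ?_)
        · exact ((hs.rel q hq p hp).sub_le).trans
            (sup_le le_sup_right (le_sup_left.trans le_sup_left))
        · exact le_sup_right.trans le_sup_left
      have h2 : φ (q.1 - v) ≤ (q.2.1 ⊔ y) ⊔ φ (v - q.1) := by
        refine h1.trans (sup_le (hy.trans (sup_le ?_ ?_)) ?_)
        · exact le_sup_right.trans le_sup_left
        · exact (hEle q hq).trans (sup_le_sup_right le_sup_left _)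
        · exact le_sup_left.trans le_sup_left
      exact (hφ.disjoint_sub _ _).left_le_of_le_sup_right h2
    have key4 : ∀ q ∈ s, q.2.2 ≤ y ⊔ φ (v - q.1) := by
      intro q hq
      have h1 : q.2.2 ≤ F ⊔ φ (v - q.1) := by
        refine leF _ _ fun p hp => ((hs.rel q hq p hp).snd_le).trans (sup_le ?_ ?_)
        · exact le_sup_left.trans le_sup_left
        · exact (hφ.map_sub_le p.1 v q.1).trans
            (sup_le (le_sup_right.trans le_sup_left) le_sup_right)
      have h2 : q.2.2 ≤ (y ⊔ φ (v - q.1)) ⊔ q.2.1 := by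
        refine h1.trans (sup_le (hy.trans (sup_le ?_ ?_)) ?_)
        · exact le_sup_left.trans le_sup_left
        · exact (hEle q hq).trans (sup_le le_sup_right (le_sup_right.trans le_sup_left))
        · exact le_sup_right.trans le_sup_left
      exact (hs.disj q hq).symm.left_le_of_le_sup_right h2
    rintro p (rfl | hp) q (rfl | hq)
    · exact hself
    · exact ⟨key1 q hq, hxE.trans (hEle q hq), hyF.trans (hFle q hq)⟩
    · exact ⟨key3 p hp, key2 p hp, key4 p hp⟩
    · exact hs.rel p hp q hq
  · rintro p (rfl | hp)
    · exact hd
    · exact hs.disj p hp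

/-- Over a countable group, a cut can be chosen with prescribed position over `0`. -/
theorem IsConeMap.exists_cut {W D : Type*} [AddCommGroup W] [Countable W] [DistribLattice D]
    [OrderBot D] (hD : CompletelyNormal D) {φ : W → D} (hφ : IsConeMap φ) (a : D) :
    ∃ α β : W → D, β 0 = a ∧ IsPartialCut φ (Set.range fun v => (v, α v, β v)) := by
  classical
  let Q := {s : Finset (W × D × D) // s.Nonempty ∧ IsPartialCut φ (s : Set (W × D × D))}
  -- The prescribed value enters as the one-point initial cut `[0 < t] = a`, `[t < 0] = ⊥`.
  have h0 : IsPartialCut φ (({((0 : W), (⊥ : D), a)} : Finset (W × D × D)) : Set (W × D × D)) := by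
    rw [Finset.coe_singleton]
    refine ⟨?_, ?_⟩
    · rintro p rfl q rfl
      exact ⟨by simp [hφ.map_zero], by simp, by simp⟩
    · rintro p rfl
      exact disjoint_bot_left
  let s₀ : Q := ⟨{(0, ⊥, a)}, Finset.singleton_nonempty _, h0⟩
  let 𝒟 : W → Order.Cofinal Q := fun v =>
    { carrier := {s | ∃ p ∈ s.1, p.1 = v}
      isCofinal := by
        rintro ⟨s, hne, hs⟩
        obtain ⟨x, y, h⟩ := hs.exists_insert hD hφ hne v
        refine ⟨⟨insert (v, x, y) s, Finset.insert_nonempty _ _, by rwa [Finset.coe_insert]⟩,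
          ⟨(v, x, y), Finset.mem_insert_self _ _, rfl⟩, ?_⟩
        exact Finset.subset_insert _ _ }
  have : Encodable W := Encodable.ofCountable W
  let I := Order.idealOfCofinals s₀ 𝒟
  have hex : ∀ v : W, ∃ x y : D, ∃ s ∈ I, (v, x, y) ∈ s.1 := by
    intro v
    obtain ⟨s, ⟨⟨v', x, y⟩, hp, rfl⟩, hsI⟩ := Order.cofinal_meets_idealOfCofinals s₀ 𝒟 v
    exact ⟨x, y, s, hsI, hp⟩
  choose α β σ hσ hmem using hex
  have hrel : ∀ s ∈ I, ∀ s' ∈ I, ∀ p ∈ s.1, ∀ q ∈ s'.1, CutRel φ p q := by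
    intro s hs s' hs' p hp q hq
    obtain ⟨t, -, hst, hs't⟩ := I.directed s hs s' hs'
    exact t.2.2.rel p (hst hp) q (hs't hq)
  refine ⟨α, β, ?_, ?_, ?_⟩
  -- Two entries over the same point `0` have equal third components, by `snd_le` in both
  -- directions, so `β 0` is the initial value.
  · have hs₀ : s₀ ∈ I := Order.mem_idealOfCofinals s₀ 𝒟
    have hm : ((0 : W), (⊥ : D), a) ∈ s₀.1 := Finset.mem_singleton_self _
    have h1 := (hrel _ (hσ 0) _ hs₀ _ (hmem 0) _ hm).snd_le
    have h2 := (hrel _ hs₀ _ (hσ 0) _ hm _ (hmem 0)).snd_le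
    simp only [sub_zero, hφ.map_zero, sup_bot_eq] at h1 h2
    exact le_antisymm h1 h2
  · rintro _ ⟨v, rfl⟩ _ ⟨w, rfl⟩
    exact hrel _ (hσ v) _ (hσ w) _ (hmem v) _ (hmem w)
  · rintro _ ⟨v, rfl⟩
    exact (σ v).2.2.disj _ (hmem v)

/-! ### Adjoining one variable -/

/-- The map on `W × ℚ` obtained from `φ` on `W` by adjoining an element `t` with
`α v = [t < v]` and `β v = [v < t]`; here `(w, c)` stands for `w + c • t`. -/
noncomputable def cutExtension {W D : Type*} [AddCommGroup W] [Module ℚ W] (φ α β : W → D)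
    (x : W × ℚ) : D :=
  if x.2 = 0 then φ x.1 else if 0 < x.2 then β (-x.2⁻¹ • x.1) else α (-x.2⁻¹ • x.1)

section CutExtension

variable {W D : Type*} [AddCommGroup W] [Module ℚ W] {φ α β : W → D}

theorem cutExtension_zero (w : W) : cutExtension φ α β (w, 0) = φ w := by
  simp [cutExtension]

theorem cutExtension_pos {c : ℚ} (hc : 0 < c) (w : W) :
    cutExtension φ α β (w, c) = β (-c⁻¹ • w) := by
  simp [cutExtension, hc, hc.ne']

theorem cutExtension_neg {c : ℚ} (hc : c < 0) (w : W) :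
    cutExtension φ α β (w, c) = α (-c⁻¹ • w) := by
  simp [cutExtension, hc.ne, hc.not_gt]

variable [DistribLattice D] [OrderBot D]

/-- Modulo a prime ideal `P`, `φ` is a total preorder on `W`, and membership of `α v` or `β v` in
`P` reads `v ≤ t` or `t ≤ v`. Subadditivity becomes closure of the negative cone under addition,
proved by cases on the signs of the coefficients of `t`. -/
theorem IsPartialCut.isConeMap_cutExtension (hφ : IsConeMap φ)
    (h : IsPartialCut φ (Set.range fun v => (v, α v, β v))) :
    IsConeMap (cutExtension φ α β) where
  map_zero := by
    rw [Prod.zero_eq_mk, cutExtension_zero, hφ.map_zero]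
  inf_map_neg := by
    have hd : ∀ v, α v ⊓ β v = ⊥ := fun v => disjoint_iff.1 (h.disj _ ⟨v, rfl⟩)
    rintro ⟨w, c⟩
    have e : -(-c)⁻¹ • (-w) = -c⁻¹ • w := by rw [inv_neg]; module
    rw [Prod.neg_mk]
    rcases lt_trichotomy c 0 with hc | rfl | hc
    · rw [cutExtension_neg hc, cutExtension_pos (neg_pos.2 hc), e, hd]
    · rw [neg_zero, cutExtension_zero, cutExtension_zero, hφ.inf_map_neg]
    · rw [cutExtension_pos hc, cutExtension_neg (neg_neg_of_pos hc), e, inf_comm, hd]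
  map_add_le := by
    intro x y
    refine le_of_forall_prime_ideal fun P hP hxy => ?_
    have hx : cutExtension φ α β x ∈ P := P.lower le_sup_left hxy
    have hy : cutExtension φ α β y ∈ P := P.lower le_sup_right hxy
    have hrel : ∀ v w, CutRel φ (v, α v, β v) (w, α w, β w) :=
      fun v w => h.rel _ ⟨v, rfl⟩ _ ⟨w, rfl⟩
    have hBA : ∀ v w, β w ∈ P → α v ∈ P → φ (v - w) ∈ P := fun v w hw hv =>
      P.lower (hrel v w).sub_le (P.sup_mem hv hw)
    have hA : ∀ v w, α w ∈ P → φ (v - w) ∈ P → α v ∈ P := fun v w hw hv =>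
      P.lower (hrel v w).fst_le (P.sup_mem hw hv)
    have hB : ∀ v w, β w ∈ P → φ (w - v) ∈ P → β v ∈ P := fun v w hw hv =>
      P.lower (hrel v w).snd_le (P.sup_mem hw hv)
    have hsmul : ∀ {c : ℚ} {v w : W}, 0 < c → φ v ∈ P → w = c • v → φ w ∈ P := by
      rintro c v w hc hv rfl
      rwa [hφ.map_smul hc]
    have zero_any : ∀ (w w' : W) (c : ℚ), φ w ∈ P → cutExtension φ α β (w', c) ∈ P →
        cutExtension φ α β (w + w', c) ∈ P := by
      intro w w' c hw hw'
      rcases lt_trichotomy c 0 with hc | rfl | hc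
      · rw [cutExtension_neg hc] at hw' ⊢
        exact hA _ _ hw' (hsmul (c := -c⁻¹) (neg_pos.2 (inv_lt_zero.2 hc)) hw (by module))
      · rw [cutExtension_zero] at hw' ⊢
        exact hφ.add_mem hw hw'
      · rw [cutExtension_pos hc] at hw' ⊢
        exact hB _ _ hw' (hsmul (c := c⁻¹) (inv_pos.2 hc) hw (by module))
    have pos_neg : ∀ (w w' : W) (c c' : ℚ), 0 < c → c' < 0 → cutExtension φ α β (w, c) ∈ P →
        cutExtension φ α β (w', c') ∈ P → cutExtension φ α β (w + w', c + c') ∈ P := by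
      intro w w' c c' hc hc' hw hw'
      have hc0 := hc.ne'
      have hc0' := hc'.ne
      rw [cutExtension_pos hc] at hw
      rw [cutExtension_neg hc'] at hw'
      have hle := hBA _ _ hw hw'
      rcases lt_trichotomy (c + c') 0 with hs | hs | hs
      · have hs0 := hs.ne
        rw [cutExtension_neg hs]
        refine hA _ _ hw' (hsmul (c := -(c + c')⁻¹ * c)
          (mul_pos (neg_pos.2 (inv_lt_zero.2 hs)) hc) hle ?_)
        match_scalars <;> field_simp
        ring
      · obtain rfl : c' = -c := by linarith
        rw [hs, cutExtension_zero]
        refine hsmul hc hle ?_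
        match_scalars <;> field_simp
      · have hs0 := hs.ne'
        rw [cutExtension_pos hs]
        refine hB _ _ hw (hsmul (c := (c + c')⁻¹ * (-c'))
          (mul_pos (inv_pos.2 hs) (neg_pos.2 hc')) hle ?_)
        match_scalars <;> field_simp
        ring
    have pos_pos : ∀ (w w' : W) (c c' : ℚ), 0 < c → 0 < c' → cutExtension φ α β (w, c) ∈ P →
        cutExtension φ α β (w', c') ∈ P → φ (-c⁻¹ • w - -c'⁻¹ • w') ∈ P →
        cutExtension φ α β (w + w', c + c') ∈ P := by
      intro w w' c c' hc hc' hw hw' hle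
      have hc0 := hc.ne'
      have hc0' := hc'.ne'
      have hs := add_pos hc hc'
      have hs0 := hs.ne'
      rw [cutExtension_pos hc] at hw
      rw [cutExtension_pos hs]
      -- The threshold of the sum is a convex combination of the thresholds `-c⁻¹ • w` and `-c'⁻¹ •
      -- w'`, with weight `(c + c')⁻¹ * c'` on the latter, so it lies above the smaller one, which
      -- already bounds `t`.
      refine hB _ _ hw (hsmul (c := (c + c')⁻¹ * c') (mul_pos (inv_pos.2 hs) hc') hle ?_)
      match_scalars <;> field_simp
      ring
    have neg_add_neg : ∀ (w w' : W) (c c' : ℚ), c < 0 → c' < 0 → cutExtension φ α β (w, c) ∈ P →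
        cutExtension φ α β (w', c') ∈ P → φ (-c'⁻¹ • w' - -c⁻¹ • w) ∈ P →
        cutExtension φ α β (w + w', c + c') ∈ P := by
      intro w w' c c' hc hc' hw hw' hle
      have hc0 := hc.ne
      have hc0' := hc'.ne
      have hs := add_neg hc hc'
      have hs0 := hs.ne
      rw [cutExtension_neg hc] at hw
      rw [cutExtension_neg hs]
      refine hA _ _ hw (hsmul (c := (c + c')⁻¹ * c')
        (mul_pos_of_neg_of_neg (inv_lt_zero.2 hs) hc') hle ?_)
      match_scalars <;> field_simp
      ring
    obtain ⟨w, c⟩ := x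
    obtain ⟨w', c'⟩ := y
    rw [Prod.mk_add_mk]
    rcases eq_or_ne c 0 with rfl | hc0
    · rw [cutExtension_zero] at hx
      rw [zero_add]
      exact zero_any _ _ _ hx hy
    rcases eq_or_ne c' 0 with rfl | hc0'
    · rw [cutExtension_zero] at hy
      rw [add_zero, add_comm]
      exact zero_any _ _ _ hy hx
    have htot := hφ.mem_or_neg_mem hP (-c⁻¹ • w - -c'⁻¹ • w')
    rw [neg_sub] at htot
    rcases hc0.lt_or_gt with hc | hc <;> rcases hc0'.lt_or_gt with hc' | hc'
    · rcases htot with ht | ht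
      · rw [add_comm w, add_comm c]
        exact neg_add_neg _ _ _ _ hc' hc hy hx ht
      · exact neg_add_neg _ _ _ _ hc hc' hx hy ht
    · rw [add_comm w, add_comm c]
      exact pos_neg _ _ _ _ hc' hc hy hx
    · exact pos_neg _ _ _ _ hc hc' hx hy
    · rcases htot with ht | ht
      · exact pos_pos _ _ _ _ hc hc' hx hy ht
      · rw [add_comm w, add_comm c]
        exact pos_pos _ _ _ _ hc' hc hy hx ht

end CutExtension

/-- A map into a completely normal lattice extends by one variable with a prescribed value. -/
theorem IsConeMap.exists_extension {W D : Type*} [AddCommGroup W] [Module ℚ W] [Countable W]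
    [DistribLattice D] [OrderBot D] (hD : CompletelyNormal D) {φ : W → D} (hφ : IsConeMap φ)
    (a : D) : ∃ ψ : W × ℚ → D, IsConeMap ψ ∧ (∀ w, ψ (w, 0) = φ w) ∧ ψ (0, 1) = a := by
  obtain ⟨α, β, h0, h⟩ := hφ.exists_cut hD a
  refine ⟨cutExtension φ α β, h.isConeMap_cutExtension hφ, cutExtension_zero, ?_⟩
  rw [cutExtension_pos one_pos, smul_zero, h0]

/-! ### Totally ordered quotients and the ℓ-group they generate -/

/-- The quotient of a group by the total preorder that a prime ideal induces through a cone map. -/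
theorem IsConeMap.exists_linearOrder {A D : Type u} [AddCommGroup A] [DistribLattice D]
    [OrderBot D] {φ : A → D} (h : IsConeMap φ) {P : Order.Ideal D} (hP : P.IsPrime) :
    ∃ (Q : Type u) (_ : AddCommGroup Q) (_ : LinearOrder Q) (_ : IsOrderedAddMonoid Q)
      (f : A →+ Q), ∀ x, f x ≤ 0 ↔ φ x ∈ P := by
  classical
  have h0 : φ 0 ∈ P := by rw [h.map_zero]; exact P.bot_mem
  let N : AddSubgroup A :=
    { carrier := {x | φ x ∈ P ∧ φ (-x) ∈ P}
      zero_mem' := ⟨h0, by rwa [neg_zero]⟩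
      add_mem' := fun {x y} hx hy =>
        ⟨h.add_mem hx.1 hy.1, by rw [neg_add]; exact h.add_mem hx.2 hy.2⟩
      neg_mem' := fun {x} hx => ⟨hx.2, by rw [neg_neg]; exact hx.1⟩ }
  have hmk : ∀ x y : A, (x : A ⧸ N) = y → φ (-y) ∈ P → φ (-x) ∈ P := by
    intro x y hxy hy
    have h1 : φ (-x + y) ∈ P := (QuotientAddGroup.eq.1 hxy).1
    simpa using h.add_mem h1 hy
  let C : AddGroupCone (A ⧸ N) :=
    { carrier := {q | ∃ x : A, (x : A ⧸ N) = q ∧ φ (-x) ∈ P}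
      zero_mem' := ⟨0, rfl, by rwa [neg_zero]⟩
      add_mem' := by
        rintro _ _ ⟨x, rfl, hx⟩ ⟨y, rfl, hy⟩
        exact ⟨x + y, rfl, by rw [neg_add]; exact h.add_mem hx hy⟩
      eq_zero_of_mem_of_neg_mem' := by
        rintro _ ⟨x, rfl, hx⟩ ⟨y, hy, hy'⟩
        have h1 : φ (-(-x)) ∈ P := hmk (-x) y hy.symm hy'
        rw [neg_neg] at h1
        exact (QuotientAddGroup.eq_zero_iff x).2 ⟨h1, hx⟩ }
  have hC : ∀ x : A, (x : A ⧸ N) ∈ C ↔ φ (-x) ∈ P := by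
    intro x
    constructor
    · rintro ⟨y, hy, hy'⟩
      exact hmk x y hy.symm hy'
    · exact fun hx => ⟨x, rfl, hx⟩
  have : HasMemOrNegMem C := by
    refine ⟨fun q => ?_⟩
    obtain ⟨x, rfl⟩ := QuotientAddGroup.mk_surjective q
    rw [← QuotientAddGroup.mk_neg, hC, hC, neg_neg]
    exact (h.mem_or_neg_mem hP x).symm
  let i : LinearOrder (A ⧸ N) := LinearOrder.mkOfAddGroupCone C
  refine ⟨A ⧸ N, inferInstance, i, IsOrderedAddMonoid.mkOfCone C, QuotientAddGroup.mk' N, ?_⟩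
  intro x
  change 0 - (x : A ⧸ N) ∈ C ↔ _
  rw [zero_sub, ← QuotientAddGroup.mk_neg, hC, neg_neg]

/-- Translations preserve binary joins, so closure induction applies in one summand and then in the
other. -/
theorem add_mem_supClosure {E : Type*} [AddCommGroup E] [Lattice E] [IsOrderedAddMonoid E]
    {A : AddSubgroup E} {x y : E} (hx : x ∈ supClosure (A : Set E))
    (hy : y ∈ supClosure (A : Set E)) : x + y ∈ supClosure (A : Set E) := by
  have h1 : ∀ a ∈ A, supClosure (A : Set E) ⊆ {y | a + y ∈ supClosure (A : Set E)} := by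
    intro a ha
    refine supClosure_min (fun b hb => subset_supClosure (A.add_mem ha hb)) ?_
    intro y hy z hz
    rw [Set.mem_ofPred_eq, add_sup]
    exact supClosed_supClosure hy hz
  have h2 : supClosure (A : Set E) ⊆ {x | x + y ∈ supClosure (A : Set E)} := by
    refine supClosure_min (fun a ha => h1 a ha hy) ?_
    intro x hx z hz
    rw [Set.mem_ofPred_eq, sup_add]
    exact supClosed_supClosure hx hz
  exact h2 hx

/-- In an Abelian ℓ-group, the differences of finite joins from a subgroup form an ℓ-subgroup. -/
def supDifferences {E : Type*} [AddCommGroup E] [Lattice E] [IsOrderedAddMonoid E]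
    (A : AddSubgroup E) : AddSubgroup E where
  carrier := {g | ∃ x ∈ supClosure (A : Set E), ∃ y ∈ supClosure (A : Set E), g = x - y}
  zero_mem' := ⟨0, subset_supClosure A.zero_mem, 0, subset_supClosure A.zero_mem, by simp⟩
  add_mem' := by
    rintro _ _ ⟨x, hx, y, hy, rfl⟩ ⟨x', hx', y', hy', rfl⟩
    exact ⟨x + x', add_mem_supClosure hx hx', y + y', add_mem_supClosure hy hy',
      (add_sub_add_comm x x' y y').symm⟩
  neg_mem' := by
    rintro _ ⟨x, hx, y, hy, rfl⟩
    exact ⟨y, hy, x, hx, neg_sub x y⟩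

section SupDifferences

variable {E : Type*} [AddCommGroup E] [Lattice E] [IsOrderedAddMonoid E] {A : AddSubgroup E}

theorem sup_mem_supDifferences {g h : E} (hg : g ∈ supDifferences A) (hh : h ∈ supDifferences A) :
    g ⊔ h ∈ supDifferences A := by
  obtain ⟨x, hx, y, hy, rfl⟩ := hg
  obtain ⟨x', hx', y', hy', rfl⟩ := hh
  refine ⟨(x + y') ⊔ (x' + y), supClosed_supClosure (add_mem_supClosure hx hy')
    (add_mem_supClosure hx' hy), y + y', add_mem_supClosure hy hy', ?_⟩
  rw [sup_sub]
  congr 1 <;> abel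

theorem inf_mem_supDifferences {g h : E} (hg : g ∈ supDifferences A) (hh : h ∈ supDifferences A) :
    g ⊓ h ∈ supDifferences A := by
  rw [← neg_neg (g ⊓ h), neg_inf]
  exact neg_mem (sup_mem_supDifferences (neg_mem hg) (neg_mem hh))

theorem mem_supDifferences {x : E} (hx : x ∈ A) : x ∈ supDifferences A :=
  ⟨x, subset_supClosure hx, 0, subset_supClosure A.zero_mem, (sub_zero x).symm⟩

end SupDifferences

/-- If `g` is the difference of `⨆ f a_j` and `⨆ f b_k`, then `d` is the join over `j` of the meets
over `k` of `φ (a_j - b_k)`: at a linearly ordered coordinate, `⨆ f a_j ≤ ⨆ f b_k` means that every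
`f a_j` lies below some `f b_k`, and "some" matches meets because `P i` is prime. -/
theorem exists_forall_le_zero_iff {ι A D : Type*} {Q : ι → Type*} [∀ i, AddCommGroup (Q i)]
    [∀ i, LinearOrder (Q i)] [∀ i, IsOrderedAddMonoid (Q i)] [AddCommGroup A] [DistribLattice D]
    {φ : A → D} {P : ι → Order.Ideal D} (hP : ∀ i, (P i).IsPrime) (f : A →+ ∀ i, Q i)
    (hf : ∀ x i, f x i ≤ 0 ↔ φ x ∈ P i) {g : ∀ i, Q i} (hg : g ∈ supDifferences f.range) :
    ∃ d : D, ∀ i, g i ≤ 0 ↔ d ∈ P i := by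
  obtain ⟨x, hx, y, hy, rfl⟩ := hg
  have h1 : ∀ a ∈ f.range, supClosure (f.range : Set (∀ i, Q i)) ⊆
      {y | ∃ d : D, ∀ i, a i ≤ y i ↔ d ∈ P i} := by
    rintro _ ⟨a, rfl⟩
    refine supClosure_min ?_ ?_
    · rintro _ ⟨b, rfl⟩
      exact ⟨φ (a - b), fun i => by rw [← hf, map_sub, Pi.sub_apply, sub_nonpos]⟩
    · rintro y ⟨d, hd⟩ z ⟨e, he⟩
      refine ⟨d ⊓ e, fun i => ?_⟩
      rw [Pi.sup_apply, le_sup_iff, hd, he]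
      exact ⟨fun h => h.elim (fun h => (P i).lower inf_le_left h)
        (fun h => (P i).lower inf_le_right h), (hP i).mem_or_mem⟩
  have h2 : supClosure (f.range : Set (∀ i, Q i)) ⊆
      {x | ∃ d : D, ∀ i, x i ≤ y i ↔ d ∈ P i} := by
    refine supClosure_min (fun a ha => h1 a ha hy) ?_
    rintro x ⟨d, hd⟩ z ⟨e, he⟩
    refine ⟨d ⊔ e, fun i => ?_⟩
    rw [Pi.sup_apply, sup_le_iff, hd, he, Order.Ideal.sup_mem_iff]
  obtain ⟨d, hd⟩ := h2 hx
  exact ⟨d, fun i => by rw [Pi.sub_apply, sub_nonpos, hd]⟩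

/-! ### The induced homomorphism on principal ℓ-ideals -/

/-- A map `e` on an Abelian ℓ-group `G` that reads off, at every prime ideal of `D`, the set where
an element is nonpositive, induces a lattice homomorphism on `Id_c(G)`. -/
theorem exists_latticeHom_Idc {ι G D : Type*} [AddCommGroup G] [Lattice G] [IsOrderedAddMonoid G]
    {Q : ι → Type*} [∀ i, AddCommGroup (Q i)] [∀ i, LinearOrder (Q i)]
    [∀ i, IsOrderedAddMonoid (Q i)] [DistribLattice D] [OrderBot D] {P : ι → Order.Ideal D}
    (hP : ∀ i, (P i).IsPrime) (hsep : ∀ a b : D, (∀ i, b ∈ P i → a ∈ P i) → a ≤ b)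
    (π : ∀ i, G →+ Q i) (hsup : ∀ i g h, π i (g ⊔ h) = π i g ⊔ π i h)
    (hinf : ∀ i g h, π i (g ⊓ h) = π i g ⊓ π i h) (e : G → D)
    (he : ∀ g i, π i g ≤ 0 ↔ e g ∈ P i) :
    ∃ F : LatticeHom (Idc G) D, F ⊥ = ⊥ ∧ ∀ (a : G) (ha : 0 ≤ a), F (Idc.mk a ha) = e a := by
  have hmono : ∀ i (g h : G), g ≤ h → π i g ≤ π i h := by
    intro i g h hgh
    rw [← sup_eq_right, ← hsup, sup_eq_right.2 hgh]
  have hle : ∀ (a b : G) (ha : 0 ≤ a) (hb : 0 ≤ b), Idc.mk a ha ≤ Idc.mk b hb → e a ≤ e b := by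
    intro a b ha hb hab
    obtain ⟨n, hn⟩ := Idc.mk_le_mk.1 hab
    refine hsep _ _ fun i hi => ?_
    rw [← he] at hi ⊢
    refine (hmono i _ _ hn).trans ?_
    rw [map_nsmul]
    exact nsmul_nonpos hi n
  have heq : ∀ a b : D, (∀ i, a ∈ P i ↔ b ∈ P i) → a = b := fun a b h =>
    le_antisymm (hsep _ _ fun i => (h i).2) (hsep _ _ fun i => (h i).1)
  have hrep := fun I : Idc G => I.exists_rep
  choose r hr0 hr using hrep
  -- The value is independent of the chosen generator, so that of `I ⊔ J` or `I ⊓ J` may be computed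
  -- from the join or meet of generators of `I` and `J`.
  have hmk : ∀ (a : G) (ha : 0 ≤ a), e (r (Idc.mk a ha)) = e a := fun a ha =>
    le_antisymm (hle _ _ (hr0 _) ha (hr _).ge) (hle _ _ ha (hr0 _) (hr _).le)
  refine ⟨⟨⟨fun I => e (r I), ?_⟩, ?_⟩, ?_, hmk⟩
  · intro I J
    conv_lhs => rw [hr I, hr J, Idc.mk_sup_mk, hmk]
    refine heq _ _ fun i => ?_
    rw [← he, hsup, sup_le_iff, he, he, Order.Ideal.sup_mem_iff]
  · intro I J
    change e (r (I ⊓ J)) = e (r I) ⊓ e (r J)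
    conv_lhs => rw [hr I, hr J, Idc.mk_inf_mk, hmk]
    refine heq _ _ fun i => ?_
    rw [← he, hinf, inf_le_iff, he, he]
    exact ⟨fun h => h.elim (fun h => (P i).lower inf_le_left h)
        (fun h => (P i).lower inf_le_right h), (hP i).mem_or_mem⟩
  · refine (hmk 0 le_rfl).trans (heq _ _ fun i => ?_)
    rw [← he, map_zero]
    exact iff_of_true le_rfl (P i).bot_mem

theorem IsConeMap.exists_surjective_latticeHom {A D : Type u} [AddCommGroup A] [DistribLattice D]
    [OrderBot D] {φ : A → D} (h : IsConeMap φ) (hsurj : Function.Surjective φ) :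
    ∃ (G : Type u) (_ : AddCommGroup G) (_ : Lattice G) (_ : IsOrderedAddMonoid G)
      (f : LatticeHom (Idc G) D), f ⊥ = ⊥ ∧ Function.Surjective f := by
  have hQ := fun P : {P : Order.Ideal D // P.IsPrime} => h.exists_linearOrder P.2
  choose Q i₁ i₂ i₃ f hf using hQ
  let F : A →+ ∀ P, Q P := AddMonoidHom.mk' (fun x P => f P x) fun x y => by
    ext P
    exact map_add (f P) x y
  let H := supDifferences F.range
  let _ : Lattice H := Subtype.lattice
    (fun _ _ hx hy => sup_mem_supDifferences hx hy)
    (fun _ _ hx hy => inf_mem_supDifferences hx hy)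
  have hH : IsOrderedAddMonoid H :=
    { add_le_add_left := fun a b hab c => by
        have : (a : ∀ P, Q P) ≤ b := hab
        exact add_le_add_left this (c : ∀ P, Q P) }
  have hex := fun g : H =>
    exists_forall_le_zero_iff (fun P : {P : Order.Ideal D // P.IsPrime} => P.2) F
      (fun x P => hf P x) g.2
  choose e he using hex
  have hsep : ∀ a b : D,
      (∀ P : {P : Order.Ideal D // P.IsPrime}, b ∈ P.1 → a ∈ P.1) → a ≤ b :=
    fun a b h => le_of_forall_prime_ideal fun P hP => h ⟨P, hP⟩
  obtain ⟨Φ, h0, hΦ⟩ := exists_latticeHom_Idc (fun P : {P : Order.Ideal D // P.IsPrime} => P.2)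
    hsep (fun P => (Pi.evalAddMonoidHom Q P).comp H.subtype) (fun _ _ _ => rfl)
    (fun _ _ _ => rfl) e he
  refine ⟨H, inferInstance, inferInstance, hH, Φ, h0, fun d => ?_⟩
  obtain ⟨x, rfl⟩ := hsurj d
  let g : H := ⟨F x, mem_supDifferences ⟨x, rfl⟩⟩
  -- The positive part of `g` is nonpositive at exactly the same primes as `g`, so its ideal is sent
  -- to `φ x`.
  refine ⟨Idc.mk (g ⊔ 0) le_sup_right, ?_⟩
  rw [hΦ]
  have hmem : ∀ P : {P : Order.Ideal D // P.IsPrime}, e (g ⊔ 0) ∈ P.1 ↔ φ x ∈ P.1 := by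
    intro P
    rw [← he, ← hf]
    change f P x ⊔ 0 ≤ 0 ↔ _
    rw [sup_le_iff, and_iff_left le_rfl]
  exact le_antisymm (hsep _ _ fun P => (hmem P).2) (hsep _ _ fun P => (hmem P).1)

/-! ### Transfinite construction of a cone map -/

/-- Along a well-order whose initial segments are countable, a map with prescribed values on the
basis of a rational vector space can be constructed one variable at a time. -/
theorem CompletelyNormal.exists_isConeMap {ι D : Type*} [LinearOrder ι] [WellFoundedLT ι]
    (hι : ∀ i : ι, (Set.Iio i).Countable) [DistribLattice D] [OrderBot D]
    (hD : CompletelyNormal D) (τ : ι → D) :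
    ∃ φ : (ι →₀ ℚ) → D, IsConeMap φ ∧ ∀ i, φ (Finsupp.single i 1) = τ i := by
  classical
  let W : Set ι → Submodule ℚ (ι →₀ ℚ) := fun S => Finsupp.supported ℚ ℚ S
  have hW : ∀ {S T : Set ι}, S ⊆ T → ∀ {x}, x ∈ W S → x ∈ W T := fun hST _ hx =>
    Finsupp.supported_mono hST hx
  have hWsingle : ∀ {S : Set ι} {i}, i ∈ S → Finsupp.single i (1 : ℚ) ∈ W S := fun hi =>
    Finsupp.single_mem_supported ℚ 1 hi
  let X := {p : Set ι × ((ι →₀ ℚ) → D) // IsLowerSet p.1 ∧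
    IsConeMap (fun x : W p.1 => p.2 x) ∧ ∀ i ∈ p.1, p.2 (Finsupp.single i 1) = τ i}
  -- Values off `W p.1.1` are junk and are ignored, so `r` is only a preorder.
  let r : X → X → Prop := fun p q => p.1.1 ⊆ q.1.1 ∧ ∀ x ∈ W p.1.1, q.1.2 x = p.1.2 x
  have hchain : ∀ c : Set X, IsChain r c → ∃ ub, ∀ a ∈ c, r a ub := by
    intro c hc
    rcases c.eq_empty_or_nonempty with rfl | hne
    · refine ⟨⟨(∅, fun _ => ⊥), isLowerSet_empty, ⟨rfl, ?_, ?_⟩, ?_⟩, ?_⟩ <;> simp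
    have hdir : ∀ p ∈ c, ∀ q ∈ c, ∃ s ∈ c, r p s ∧ r q s := by
      intro p hp q hq
      by_cases hpq : p = q
      · subst hpq
        exact ⟨p, hp, ⟨subset_rfl, fun _ _ => rfl⟩, ⟨subset_rfl, fun _ _ => rfl⟩⟩
      · rcases hc hp hq hpq with h | h
        · exact ⟨q, hq, h, ⟨subset_rfl, fun _ _ => rfl⟩⟩
        · exact ⟨p, hp, ⟨subset_rfl, fun _ _ => rfl⟩, h⟩
    let U : Set ι := ⋃ p ∈ c, p.1.1
    have hU : ∀ {p : X}, p ∈ c → p.1.1 ⊆ U := fun hp => Set.subset_biUnion_of_mem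
      (u := fun p : X => p.1.1) hp
    have hcover : ∀ x ∈ W U, ∃ p ∈ c, x ∈ W p.1.1 := by
      intro x hx
      have hfin : ∀ s : Finset ι, (s : Set ι) ⊆ U → ∃ p ∈ c, (s : Set ι) ⊆ p.1.1 := by
        intro s
        induction s using Finset.induction_on with
        | empty =>
          intro _
          obtain ⟨p, hp⟩ := hne
          exact ⟨p, hp, by simp⟩
        | insert i s _ ih =>
          intro hs
          rw [Finset.coe_insert, Set.insert_subset_iff] at hs
          obtain ⟨p, hp, hsp⟩ := ih hs.2
          obtain ⟨q, hq, hiq⟩ := Set.mem_iUnion₂.1 hs.1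
          obtain ⟨t, ht, hpt, hqt⟩ := hdir p hp q hq
          refine ⟨t, ht, ?_⟩
          rw [Finset.coe_insert, Set.insert_subset_iff]
          exact ⟨hqt.1 hiq, hsp.trans hpt.1⟩
      obtain ⟨p, hp, hs⟩ := hfin x.support ((Finsupp.mem_supported ℚ x).1 hx)
      exact ⟨p, hp, (Finsupp.mem_supported ℚ x).2 hs⟩
    let φ : (ι →₀ ℚ) → D := fun x => if h : ∃ p ∈ c, x ∈ W p.1.1 then h.choose.1.2 x else ⊥
    have hφ : ∀ p ∈ c, ∀ x ∈ W p.1.1, φ x = p.1.2 x := by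
      intro p hp x hx
      have h : ∃ p ∈ c, x ∈ W p.1.1 := ⟨p, hp, hx⟩
      obtain ⟨s, hs, h1, h2⟩ := hdir p hp _ h.choose_spec.1
      simp only [φ, dif_pos h]
      rw [← h1.2 x hx, ← h2.2 x h.choose_spec.2]
    refine ⟨⟨(U, φ), ?_, ⟨?_, ?_, ?_⟩, ?_⟩, fun p hp => ⟨hU hp, hφ p hp⟩⟩
    · exact isLowerSet_iUnion₂ fun p _ => p.2.1
    · obtain ⟨p, hp⟩ := hne
      exact (hφ p hp 0 (zero_mem _)).trans p.2.2.1.map_zero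
    · rintro ⟨x, hx⟩ ⟨y, hy⟩
      obtain ⟨p, hp, hxp⟩ := hcover x hx
      obtain ⟨q, hq, hyq⟩ := hcover y hy
      obtain ⟨s, hs, h1, h2⟩ := hdir p hp q hq
      have hxs := hW h1.1 hxp
      have hys := hW h2.1 hyq
      change φ (x + y) ≤ φ x ⊔ φ y
      rw [hφ s hs _ hxs, hφ s hs _ hys, hφ s hs _ (add_mem hxs hys)]
      exact s.2.2.1.map_add_le ⟨x, hxs⟩ ⟨y, hys⟩
    · rintro ⟨x, hx⟩
      obtain ⟨p, hp, hxp⟩ := hcover x hx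
      change φ x ⊓ φ (-x) = ⊥
      rw [hφ p hp _ hxp, hφ p hp _ (neg_mem hxp)]
      exact p.2.2.1.inf_map_neg ⟨x, hxp⟩
    · intro i hi
      obtain ⟨p, hp, hip⟩ := Set.mem_iUnion₂.1 hi
      exact (hφ p hp _ (hWsingle hip)).trans (p.2.2.2 i hip)
  obtain ⟨⟨⟨S, φ⟩, hS, hφ, hτ⟩, hmax⟩ := exists_maximal_of_chains_bounded hchain
    fun {a b c} hab hbc => ⟨hab.1.trans hbc.1,
      fun x hx => (hbc.2 x (hW hab.1 hx)).trans (hab.2 x hx)⟩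
  dsimp only at hS hφ hτ
  by_cases hSu : S = Set.univ
  · subst hSu
    refine ⟨φ, ?_, fun i => hτ i (Set.mem_univ i)⟩
    have hu : ∀ x, x ∈ W Set.univ := fun x => (Finsupp.mem_supported ℚ x).2 (Set.subset_univ _)
    exact hφ.comp (LinearMap.codRestrict (W Set.univ) LinearMap.id hu).toAddMonoidHom
  exfalso
  have hne : Sᶜ.Nonempty := Set.nonempty_compl.2 hSu
  obtain ⟨i, hiS, hmin⟩ := wellFounded_lt.has_min Sᶜ hne
  -- Because `S` is a lower set and `i` is least outside it, `S` is the initial segment below `i`,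
  -- hence countable, and one more variable can be adjoined.
  have hSi : S ⊆ Set.Iio i := fun j hj => lt_of_not_ge fun hij => hiS (hS hij hj)
  have hiS' : Set.Iio i ⊆ S := fun j hj => by
    by_contra hjS
    exact hmin j hjS hj
  have : Countable S := ((hι i).mono hSi).to_subtype
  have : Countable (W S) :=
    (Finsupp.supportedEquivFinsupp (M := ℚ) (R := ℚ) S).toEquiv.countable_iff.2
      inferInstance
  obtain ⟨ψ, hψ, hψφ, hψi⟩ := hφ.exists_extension hD (τ i)
  let R : (ι →₀ ℚ) →ₗ[ℚ] W S := Finsupp.restrictDom ℚ ℚ S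
  let ρ : (ι →₀ ℚ) →ₗ[ℚ] W S × ℚ := R.prod (Finsupp.lapply i)
  have hρ : ∀ x (hx : x ∈ W S), ρ x = (⟨x, hx⟩, 0) := by
    intro x hx
    refine Prod.ext (Subtype.ext ?_) ?_
    · exact (Finsupp.filter_eq_self_iff _ _).2 fun j hj =>
        (Finsupp.mem_supported ℚ x).1 hx (Finsupp.mem_support_iff.2 hj)
    · exact (Finsupp.mem_supported' ℚ x).1 hx i hiS
  have hφS : ∀ x ∈ W S, ψ (ρ x) = φ x := fun x hx => by rw [hρ x hx, hψφ]
  have hρi : ρ (Finsupp.single i 1) = (0, 1) := by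
    refine Prod.ext (Subtype.ext ?_) ?_
    · exact Finsupp.filter_single_of_neg _ hiS
    · exact Finsupp.single_eq_same
  let m : X := ⟨(Set.Iic i, fun x => ψ (ρ x)), isLowerSet_Iic i,
    hψ.comp (ρ.comp (W (Set.Iic i)).subtype).toAddMonoidHom, by
      intro j hj
      rcases (Set.mem_Iic.1 hj).eq_or_lt with rfl | hj
      · exact (congrArg ψ hρi).trans hψi
      · exact (hφS _ (hWsingle (hiS' hj))).trans (hτ j (hiS' hj))⟩
  exact hiS ((hmax m ⟨hSi.trans Set.Iio_subset_Iic_self, hφS⟩).1 (Set.mem_Iic.2 le_rfl))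

theorem corollaryC (L : Type u) [DistribLattice L] [OrderBot L]
    (hL : CompletelyNormal L) (hcard : Cardinal.mk L ≤ Cardinal.aleph 1) :
    ∃ (G : Type u) (_ : AddCommGroup G) (_ : Lattice G) (_ : IsOrderedAddMonoid G)
      (f : LatticeHom (Idc G) L), f ⊥ = ⊥ ∧ Function.Surjective f := by
  let I : Type u := (Cardinal.aleph 1).ord.ToType
  have hI : Cardinal.mk I = Cardinal.aleph 1 := by simp [I]
  have hcount : ∀ i : I, (Set.Iio i).Countable := by
    intro i
    have := Cardinal.mk_Iio_lt i (by simp [I])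
    rw [← Cardinal.le_aleph0_iff_set_countable, ← Cardinal.lt_aleph_one_iff]
    exact this.trans_eq hI
  rw [← hI] at hcard
  obtain ⟨j⟩ := Cardinal.le_def _ _ |>.1 hcard
  -- A left inverse of the injection `j` labels the basis vectors, so every element of `L` is the
  -- value at some basis vector.
  obtain ⟨φ, hφ, hτ⟩ := hL.exists_isConeMap hcount (Function.invFun j)
  refine hφ.exists_surjective_latticeHom fun l => ?_
  exact ⟨Finsupp.single (j l) 1, (hτ _).trans (Function.leftInverse_invFun j.injective l)⟩
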